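/- Let $d\ge 1$ be an integer, $\alpha\in(0,d)$, $\varepsilon\in(0,\alpha]$, and put $\beta=d-\alpha+\varepsilon\in(0,d]$. **Notation.** For $E\subset\mathbb{R}^d$ let $$\mathcal{H}^\beta_\infty(E)=\inf\Big\{\sum_{i=1}^\infty\omega_\beta r_i^\beta : E\subset\bigcup_{i=1}^\infty B(x_i,r_i)\Big\},\qquad \omega_\beta=\frac{\pi^{\beta/2}}{\Gamma(\beta/2+1)},$$ be the Hausdorff content, and for $g:\mathbb{R}^d\to[0,\infty]$ and $A\subset\mathbb{R}^d$ let $$\int_A g\,d\mathcal{H}^\beta_\infty=\int_0^\infty\mathcal{H}^\beta_\infty(\{x\in A: g(x)>t\})\,dt$$ be the Choquet integral. For a set $A$, a function $f$ with values in $[-\infty,\infty]$ belongs to $L^1(A;\mathcal{H}^\beta_\infty)$ if $\int_A|f|\,d\mathcal{H}^\beta_\infty<\infty$ and $f$ is $\mathcal{H}^\beta_\infty$-quasicontinuous on $A$, i.e. for every $\delta>0$ there is an open set $O$ with $\mathcal{H}^\beta_\infty(O)<\delta$ such that $f|_{A\setminus O}$ is continuous. Let $$\|u\|_{BMO^\beta(\mathbb{R}^d)}=\sup_{Q}\inf_{c\in\mathbb{R}}\frac{1}{l(Q)^\beta}\int_Q|u-c|\,d\mathcal{H}^\beta_\infty,$$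 where the supremum is over all finite cubes $Q\subset\mathbb{R}^d$ with sides parallel to the axes and $l(Q)$ is the side length of $Q$. For a locally finite signed Radon measure $\mu=\mu^+-\mu^-$ on $\mathbb{R}^d$ (Jordan decomposition, $|\mu|=\mu^++\mu^-$) let $$\|\mu\|_{\mathcal{M}^{d-\alpha}(\mathbb{R}^d)}=\sup_{x\in\mathbb{R}^d,\,r>0}\frac{|\mu|(B(x,r))}{r^{d-\alpha}},$$ and let $\mathcal{M}^{d-\alpha}(\mathbb{R}^d)$ be the set of those $\mu$ for which this is finite. The Riesz potential of $\mu$ is $$I_\alpha\mu(x)=\frac{1}{\gamma(\alpha)}\int_{\mathbb{R}^d}\frac{d\mu(y)}{|x-y|^{d-\alpha}},\qquad \gamma(\alpha)=\frac{\pi^{d/2}\,2^\alpha\,\Gamma(\alpha/2)}{\Gamma((d-\alpha)/2)},$$ that is, the difference of the potentials of $\mu^+$ and $\mu^-$; a point where both of these are infinite is counted as a point where $|I_\alpha\mu|=\infty$. **Theorem.** There is a constant $C>0$, depending only on $d$, $\alpha$ and $\varepsilon$, such that $$\|I_\alpha\mu\|_{BMO^{d-\alpha+\varepsilon}(\mathbb{R}^d)}\le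 C\,\|\mu\|_{\mathcal{M}^{d-\alpha}(\mathbb{R}^d)}$$ for all $\mu\in\mathcal{M}^{d-\alpha}(\mathbb{R}^d)$ such that $I_\alpha\mu\in L^1(K;\mathcal{H}^{d-\alpha+\varepsilon}_\infty)$ for every compact set $K\subset\mathbb{R}^d$. -/

import Mathlib

open MeasureTheory Set
open scoped ENNReal

noncomputable section

namespace HausdorffBMO

/-- The Euclidean space `ℝ^d`. -/
abbrev Space (d : ℕ) : Type := EuclideanSpace ℝ (Fin d)

/-- The normalization constant `ω_β = π^(β/2) / Γ(β/2 + 1)`. -/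
def omega (β : ℝ) : ℝ := Real.pi ^ (β / 2) / Real.Gamma (β / 2 + 1)

/-- The spherical Hausdorff content of dimension `β`:
the infimum of `∑ ω_β r_i^β` over the countable covers of `S` by balls `B(x_i, r_i)`. -/
def hausdorffContent {d : ℕ} (β : ℝ) (S : Set (Space d)) : ℝ≥0∞ :=
  ⨅ (x : ℕ → Space d) (r : ℕ → ℝ) (_ : ∀ i, 0 < r i) (_ : S ⊆ ⋃ i, Metric.ball (x i) (r i)),
    ∑' i, ENNReal.ofReal (omega β * r i ^ β)

/-- The Choquet integral `∫_A g dH = ∫_0^∞ H({x ∈ A : g(x) > t}) dt` of a function with values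
in `[0,∞]` with respect to a set function `H`. -/
def choquetIntegral {d : ℕ} (H : Set (Space d) → ℝ≥0∞) (A : Set (Space d))
    (g : Space d → ℝ≥0∞) : ℝ≥0∞ :=
  ∫⁻ t in Ioi (0 : ℝ), H {x | x ∈ A ∧ ENNReal.ofReal t < g x}

/-- Quasicontinuity on `A` with respect to the `β`-dimensional Hausdorff content, for functions
with values in `[-∞,∞]`. -/
def QuasicontinuousOn {d : ℕ} (β : ℝ) (A : Set (Space d)) (f : Space d → EReal) : Prop :=
  ∀ δ : ℝ≥0∞, 0 < δ → ∃ O : Set (Space d), IsOpen O ∧ hausdorffContent β O < δ ∧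
    ContinuousOn f (A \ O)

/-- Membership in `L¹(A; H^β_∞)`: quasicontinuity on `A` and a finite Choquet integral of `|f|`
over `A`. The latter forces `{x ∈ A : |f(x)| = ∞}` to be a set of content zero. -/
def MemL1 {d : ℕ} (β : ℝ) (A : Set (Space d)) (f : Space d → EReal) : Prop :=
  QuasicontinuousOn β A f ∧ choquetIntegral (hausdorffContent β) A (fun x => (f x).abs) < ∞

/-- The half-open cube with sides of length `l` parallel to the axes and lower corner `a`. -/
def cube {d : ℕ} (a : Space d) (l : ℝ) : Set (Space d) :=
  {x | ∀ i, a i ≤ x i ∧ x i < a i + l}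

/-- The semi-norm of `BMO^β(ℝ^d)`: the supremum over all finite cubes `Q` parallel to the axes of
`inf_{c ∈ ℝ} l(Q)^(-β) ∫_Q |u - c| dH^β_∞`. -/
def bmoSeminorm {d : ℕ} (β : ℝ) (u : Space d → EReal) : ℝ≥0∞ :=
  ⨆ (a : Space d) (l : ℝ) (_ : 0 < l), ⨅ c : ℝ,
    choquetIntegral (hausdorffContent β) (cube a l) (fun x => (u x - (c : EReal)).abs) /
      ENNReal.ofReal (l ^ β)

/-- A locally finite signed Radon measure on `ℝ^d`, given by its Jordan decomposition: the
difference `μ⁺ - μ⁻` of two locally finite, mutually singular Borel measures (which is a set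
function on the bounded Borel sets, as both parts may have infinite total mass). -/
structure SignedRadonMeasure (d : ℕ) where
  /-- the positive part `μ⁺` -/
  posPart : Measure (Space d)
  /-- the negative part `μ⁻` -/
  negPart : Measure (Space d)
  posPart_locallyFinite : IsLocallyFiniteMeasure posPart
  negPart_locallyFinite : IsLocallyFiniteMeasure negPart
  mutuallySingular : posPart ⟂ₘ negPart

/-- The total variation measure `|μ| = μ⁺ + μ⁻`. -/
def SignedRadonMeasure.variation {d : ℕ} (μ : SignedRadonMeasure d) : Measure (Space d) :=
  μ.posPart + μ.negPart

/-- The Morrey norm `sup_{x, r > 0} |μ|(B(x,r)) / r^s`. -/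
def morreyNorm {d : ℕ} (s : ℝ) (μ : SignedRadonMeasure d) : ℝ≥0∞ :=
  ⨆ (x : Space d) (r : ℝ) (_ : 0 < r),
    μ.variation (Metric.ball x r) / ENNReal.ofReal (r ^ s)

/-- The normalization constant `γ(α) = π^(d/2) 2^α Γ(α/2) / Γ((d-α)/2)` of the Riesz potential. -/
def rieszConst (d : ℕ) (α : ℝ) : ℝ :=
  Real.pi ^ ((d : ℝ) / 2) * 2 ^ α * Real.Gamma (α / 2) / Real.Gamma (((d : ℝ) - α) / 2)

/-- The Riesz potential `x ↦ γ(α)⁻¹ ∫ |x-y|^(α-d) dν(y)` of a positive measure, with values in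
`[0,∞]`; for `α < d` the kernel is `∞` at `y = x`. -/
def rieszPotentialPos {d : ℕ} (α : ℝ) (ν : Measure (Space d)) (x : Space d) : ℝ≥0∞ :=
  ENNReal.ofReal (rieszConst d α)⁻¹ * ∫⁻ y, (edist x y) ^ (-((d : ℝ) - α)) ∂ν

/-- The Riesz potential of a signed measure, `I_α μ = I_α μ⁺ - I_α μ⁻`, with values in `[-∞,∞]`.
Where both terms are infinite the integral does not exist; there the difference in `EReal` is
`⊥`, so that such a point counts as a point where `|I_α μ| = ∞`. -/
def rieszPotential {d : ℕ} (α : ℝ) (μ : SignedRadonMeasure d) (x : Space d) : EReal :=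
  ((rieszPotentialPos α μ.posPart x : ℝ≥0∞) : EReal) -
    ((rieszPotentialPos α μ.negPart x : ℝ≥0∞) : EReal)

end HausdorffBMO

end

noncomputable section

namespace HausdorffBMO

/-! ### Hausdorff content and the fractional maximal function -/

section Content

variable {d : ℕ} {β : ℝ}

/-! Write s = d - α, β = s + ε, ν = |μ|, and let m > 0 bound the Morrey norm. Put a cube Q of side l
in a ball B(a,R) with R comparable to l and split μ at the boundary of B(a,2R). The far part is
almost constant on B(a,R): by the mean value theorem the kernel varies by at most a multiple of
R|a-y|^(-s-1), and summing over dyadic annuli gives an oscillation of order m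
(`far_potential_le_add`). Its value at a serves as the constant c. It is finite because local
integrability yields a point of Q where the potential is finite (`exists_abs_ne_top`). For the near
part, suppose ν(B(x,r)) ≤ τ r^β at all radii r ≤ 6R. Combining this with ν(B(x,r)) ≤ m r^s through
their geometric mean bounds the near potential by a multiple of √(mτ) R^(ε/2)
(`lintegral_ball_kernel_le`). So it exceeds t only where the fractional maximal function exceeds
some τ of order t²/(m R^ε), and Vitali's covering lemma bounds the content of that set by a multiple
of m² R^β / t² (`hausdorffContent_local_potential_le`). The density τ r^β alone would give decay
1/t, which is not integrable at infinity. Using the trivial bound R^β for t up to order m and this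
decay beyond gives a Choquet integral of order m R^β. -/

lemma omega_pos (hβ : 0 < β) : 0 < omega β :=
  div_pos (Real.rpow_pos_of_pos Real.pi_pos _) (Real.Gamma_pos_of_pos (by positivity))

lemma hausdorffContent_mono {S T : Set (Space d)} (h : S ⊆ T) :
    hausdorffContent β S ≤ hausdorffContent β T :=
  le_iInf fun x => le_iInf fun r => le_iInf fun hr => le_iInf fun hT =>
    iInf_le_of_le x <| iInf_le_of_le r <| iInf_le_of_le hr <| iInf_le_of_le (h.trans hT) le_rfl

/-- Covers indexed by an arbitrary countable type may be used to bound the content. -/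
lemma hausdorffContent_le_tsum (hβ : 0 < β) {ι : Type*} [Countable ι] {S : Set (Space d)}
    (x : ι → Space d) (r : ι → ℝ) (hr : ∀ i, 0 < r i) (hS : S ⊆ ⋃ i, Metric.ball (x i) (r i)) :
    hausdorffContent β S ≤ ∑' i, ENNReal.ofReal (omega β * r i ^ β) := by
  refine ENNReal.le_of_forall_pos_le_add fun δ hδ _ => ?_
  -- The content requires covers indexed by ℕ with positive radii, so the family, possibly finite or
  -- empty, is padded with balls of total cost below δ.
  obtain ⟨δ', hδ', hsum⟩ := ENNReal.exists_pos_sum_of_countable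
    (ENNReal.coe_ne_zero.2 hδ.ne') ℕ
  have hω := omega_pos hβ
  let r' : ℕ → ℝ := fun k => ((δ' k : ℝ) / omega β) ^ β⁻¹
  have hr' : ∀ k, 0 < r' k := fun k =>
    Real.rpow_pos_of_pos (div_pos (NNReal.coe_pos.2 (hδ' k)) hω) _
  have hr'eq : ∀ k, ENNReal.ofReal (omega β * r' k ^ β) = δ' k := fun k => by
    have h0 : (0 : ℝ) ≤ δ' k / omega β := (div_pos (NNReal.coe_pos.2 (hδ' k)) hω).le
    simp only [r']
    rw [← Real.rpow_mul h0, inv_mul_cancel₀ hβ.ne', Real.rpow_one, mul_div_cancel₀ _ hω.ne',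
      ENNReal.ofReal_coe_nnreal]
  have : Nonempty (Denumerable (ι ⊕ ℕ)) := nonempty_denumerable _
  obtain ⟨hden⟩ := this
  let e : ℕ ≃ ι ⊕ ℕ := (Denumerable.eqv (ι ⊕ ℕ)).symm
  let X : ι ⊕ ℕ → Space d := Sum.elim x (fun _ => 0)
  let R : ι ⊕ ℕ → ℝ := Sum.elim r r'
  have hR : ∀ j, 0 < R j := by rintro (i | k); exacts [hr i, hr' k]
  have hcov : S ⊆ ⋃ n, Metric.ball (X (e n)) (R (e n)) := fun y hy => by
    obtain ⟨i, hi⟩ := mem_iUnion.1 (hS hy)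
    refine mem_iUnion.2 ⟨e.symm (Sum.inl i), ?_⟩
    simpa [X, R] using hi
  calc hausdorffContent β S ≤ ∑' n, ENNReal.ofReal (omega β * R (e n) ^ β) :=
        iInf_le_of_le _ <| iInf_le_of_le _ <| iInf_le_of_le (fun n => hR (e n)) <|
          iInf_le_of_le hcov le_rfl
    _ = ∑' j, ENNReal.ofReal (omega β * R j ^ β) :=
        e.tsum_eq (fun j => ENNReal.ofReal (omega β * R j ^ β))
    _ = (∑' i, ENNReal.ofReal (omega β * r i ^ β)) +
          ∑' k, ENNReal.ofReal (omega β * r' k ^ β) :=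
        ENNReal.summable.tsum_sum ENNReal.summable
    _ ≤ _ := by
        gcongr
        simp_rw [hr'eq]
        exact hsum.le

lemma hausdorffContent_ball_le (hβ : 0 < β) (a : Space d) {R : ℝ} (hR : 0 < R) :
    hausdorffContent β (Metric.ball a R) ≤ ENNReal.ofReal (omega β * R ^ β) := by
  have := hausdorffContent_le_tsum (S := Metric.ball a R) hβ (fun _ : Unit => a) (fun _ => R)
    (fun _ => hR) (subset_iUnion (fun _ : Unit => Metric.ball a R) ())
  simpa using this

/-- For `β ≤ d`, sets of positive Lebesgue measure have positive content. -/
lemma hausdorffContent_pos_of_volume_pos (hβ : 0 < β) (hβd : β ≤ d) {S : Set (Space d)}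
    (hS : 0 < volume S) : 0 < hausdorffContent β S := by
  have hω := omega_pos hβ
  set V := volume (Metric.ball (0 : Space d) 1) with hV
  have hV0 : V ≠ 0 := (Metric.measure_ball_pos volume _ one_pos).ne'
  have hVt : V ≠ ∞ := measure_ball_lt_top.ne
  -- A cover with a radius above 1 costs at least `omega β`. Otherwise r^d ≤ r^β for every radius,
  -- and the cost dominates a multiple of the volume.
  have hpos : 0 < min (ENNReal.ofReal (omega β)) (ENNReal.ofReal (omega β) * (volume S / V)) :=
    lt_min (ENNReal.ofReal_pos.2 hω)
      (ENNReal.mul_pos (ENNReal.ofReal_pos.2 hω).ne' (ENNReal.div_pos hS.ne' hVt).ne')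
  refine hpos.trans_le (le_iInf fun x => le_iInf fun r => le_iInf fun hr => le_iInf fun hc => ?_)
  by_cases h : ∃ i, 1 < r i
  · obtain ⟨i, hi⟩ := h
    refine (min_le_left _ _).trans (le_trans ?_ (ENNReal.le_tsum i))
    exact ENNReal.ofReal_le_ofReal (le_mul_of_one_le_right hω.le (Real.one_le_rpow hi.le hβ.le))
  · push Not at h
    refine (min_le_right _ _).trans ?_
    have hvol : volume S ≤ ∑' i, ENNReal.ofReal (r i ^ β) * V := by
      refine (measure_mono hc).trans ((measure_iUnion_le _).trans (ENNReal.tsum_le_tsum fun i => ?_))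
      rw [Measure.addHaar_ball_of_pos _ _ (hr i), finrank_euclideanSpace_fin, ← hV]
      gcongr
      rw [← Real.rpow_natCast]
      exact Real.rpow_le_rpow_of_exponent_ge (hr i) (h i) hβd
    rw [ENNReal.tsum_mul_right] at hvol
    simp_rw [ENNReal.ofReal_mul hω.le]
    rw [ENNReal.tsum_mul_left]
    gcongr
    exact ENNReal.div_le_of_le_mul hvol

lemma hausdorffContent_cube_pos (hβ : 0 < β) (hβd : β ≤ d) (a : Space d) {l : ℝ} (hl : 0 < l) :
    0 < hausdorffContent β (cube a l) := by
  refine hausdorffContent_pos_of_volume_pos hβ hβd ?_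
  have hopen : IsOpen {x : Space d | ∀ i, a i < x i ∧ x i < a i + l} := by
    simp only [ofPred_forall]
    refine isOpen_iInter_of_finite fun i => ?_
    have hc : Continuous fun x : Space d => x i := by fun_prop
    exact (isOpen_lt continuous_const hc).inter (isOpen_lt hc continuous_const)
  have hne : {x : Space d | ∀ i, a i < x i ∧ x i < a i + l}.Nonempty :=
    ⟨WithLp.toLp 2 fun i => a i + l / 2, fun i => by
      constructor <;> simp only <;> linarith⟩
  exact (hopen.measure_pos volume hne).trans_le
    (measure_mono fun x hx i => ⟨(hx i).1.le, (hx i).2⟩)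

lemma cube_subset_ball (a : Space d) {l : ℝ} (hl : 0 < l) :
    cube a l ⊆ Metric.ball a ((√d + 1) * l) := by
  intro x hx
  rw [Metric.mem_ball, EuclideanSpace.dist_eq]
  have h : ∑ i, dist (x i) (a i) ^ 2 ≤ d * l ^ 2 := by
    calc ∑ i, dist (x i) (a i) ^ 2 ≤ ∑ _i : Fin d, l ^ 2 := by
          refine Finset.sum_le_sum fun i _ => ?_
          have := hx i
          rw [Real.dist_eq, sq_abs]
          nlinarith
      _ = d * l ^ 2 := by simp
  refine (Real.sqrt_le_sqrt h).trans_lt ?_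
  rw [Real.sqrt_mul (Nat.cast_nonneg d), Real.sqrt_sq hl.le]
  linarith

/-- Weak type estimate for the fractional maximal function. -/
lemma hausdorffContent_maximal_le (hβ : 0 < β) (ν : Measure (Space d)) (a : Space d)
    {R L τ : ℝ} (hL : 0 < L) (hτ : 0 < τ) (hfin : ν (Metric.ball a (R + 2 * L)) ≠ ∞) :
    hausdorffContent β {x | x ∈ Metric.ball a R ∧
        ∃ r, 0 < r ∧ r ≤ L ∧ ENNReal.ofReal (τ * r ^ β) < ν (Metric.ball x r)} ≤
      ENNReal.ofReal (omega β * 6 ^ β / τ) * ν (Metric.ball a (R + 2 * L)) := by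
  have hω := omega_pos hβ
  set S := {x | x ∈ Metric.ball a R ∧
        ∃ r, 0 < r ∧ r ≤ L ∧ ENNReal.ofReal (τ * r ^ β) < ν (Metric.ball x r)} with hSdef
  choose! ρ hρ0 hρL hρ using fun x (hx : x ∈ S) => hx.2
  -- The closed balls of radius 5ρ cover, hence so do the open balls of radius 6ρ, which is the
  -- source of 6^β.
  obtain ⟨u, huS, hdisj, hcov⟩ := Vitali.exists_disjoint_subfamily_covering_enlargement_closedBall
    S id ρ L hρL 5 (by norm_num)
  have hsub : ∀ x ∈ u, Metric.closedBall x (ρ x) ⊆ Metric.ball a (R + 2 * L) := fun x hx y hy => by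
    have h1 := Metric.mem_ball.1 (huS hx).1
    have h2 := Metric.mem_closedBall.1 hy
    have h3 := hρL x (huS hx)
    rw [Metric.mem_ball]
    linarith [dist_triangle y x a]
  have hlow : ∀ x ∈ u, ENNReal.ofReal (τ * ρ x ^ β) ≤ ν (Metric.closedBall x (ρ x)) := fun x hx =>
    (hρ x (huS hx)).le.trans (measure_mono Metric.ball_subset_closedBall)
  have hdisj' : Pairwise (Function.onFun Disjoint
      fun i : u => Metric.closedBall (i : Space d) (ρ i)) := fun i j hij =>
    hdisj i.2 j.2 (fun h => hij (Subtype.ext h))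
  have hsum : ∑' i : u, ν (Metric.closedBall (i : Space d) (ρ i)) ≤
      ν (Metric.ball a (R + 2 * L)) :=
    (tsum_meas_le_meas_iUnion_of_disjoint ν (fun _ => Metric.isClosed_closedBall.measurableSet)
      hdisj').trans (measure_mono (iUnion_subset fun i => hsub i i.2))
  -- Disjoint balls of positive mass inside a ball of finite mass are countably many.
  have : Countable u := by
    have hc := Summable.countable_support_ennreal (ne_top_of_le_ne_top hfin hsum)
    have : Function.support (fun i : u => ν (Metric.closedBall (i : Space d) (ρ i))) = univ :=
      eq_univ_of_forall fun i => ne_of_gt (lt_of_lt_of_le (ENNReal.ofReal_pos.2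
        (mul_pos hτ (Real.rpow_pos_of_pos (hρ0 i (huS i.2)) _))) (hlow i i.2))
    rw [this] at hc
    exact countable_univ_iff.1 hc
  refine (hausdorffContent_le_tsum hβ (fun i : u => (i : Space d)) (fun i => 6 * ρ i)
    (fun i => by have := hρ0 i (huS i.2); positivity) fun x hx => ?_).trans ?_
  · obtain ⟨b, hb, hxb⟩ := hcov x hx
    refine mem_iUnion.2 ⟨⟨b, hb⟩, ?_⟩
    have h1 := Metric.mem_closedBall.1 (hxb (Metric.mem_closedBall_self (hρ0 x hx).le))
    have h2 := hρ0 b (huS hb)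
    simp only [id] at h1
    rw [Metric.mem_ball]
    linarith
  · calc ∑' i : u, ENNReal.ofReal (omega β * (6 * ρ i) ^ β)
        ≤ ∑' i : u, ENNReal.ofReal (omega β * 6 ^ β / τ) *
            ν (Metric.closedBall (i : Space d) (ρ i)) := by
          refine ENNReal.tsum_le_tsum fun i => ?_
          have h2 := hρ0 i (huS i.2)
          refine le_trans (le_of_eq ?_) (mul_le_mul_right (hlow i i.2) _)
          rw [← ENNReal.ofReal_mul (by positivity), Real.mul_rpow (by norm_num) h2.le]
          congr 1
          field_simp
      _ ≤ _ := by
          rw [ENNReal.tsum_mul_left]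
          gcongr

end Content

/-! ### Riesz kernel estimates, near and far -/

section Kernel

variable {d : ℕ}

lemma edist_rpow_neg (s : ℝ) {x y : Space d} (h : 0 < dist x y) :
    edist x y ^ (-s) = ENNReal.ofReal (dist x y ^ (-s)) := by
  rw [edist_dist, ENNReal.ofReal_rpow_of_pos h]

lemma le_ofReal_mul_sqrt {v : ℝ≥0∞} {a b : ℝ} (ha : 0 ≤ a) (hb : 0 ≤ b)
    (h1 : v ≤ ENNReal.ofReal a) (h2 : v ≤ ENNReal.ofReal b) : v ≤ ENNReal.ofReal √(a * b) := by
  rcases le_total a b with h | h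
  · exact h1.trans (ENNReal.ofReal_le_ofReal (Real.le_sqrt_of_sq_le (by nlinarith)))
  · exact h2.trans (ENNReal.ofReal_le_ofReal (Real.le_sqrt_of_sq_le (by nlinarith)))

/-- Dyadic decomposition of the Riesz kernel near its pole. -/
lemma edist_rpow_neg_le_tsum {s ρ : ℝ} (hs : 0 < s) (hρ : 0 < ρ) {x y : Space d}
    (hy : y ∈ Metric.ball x ρ) :
    edist x y ^ (-s) ≤ ∑' k : ℕ, (Metric.ball x (2 * ρ * (1 / 2) ^ k)).indicator
      (fun _ => ENNReal.ofReal ((2 * ρ * (1 / 2) ^ k / 4) ^ (-s))) y := by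
  rcases eq_or_lt_of_le (dist_nonneg (x := x) (y := y)) with h0 | h0
  -- At the pole every term is at least (2ρ/4)^(-s) > 0, so the series diverges.
  · have hxy : x = y := dist_eq_zero.1 h0.symm
    subst hxy
    have hle : ∑' _k : ℕ, ENNReal.ofReal ((2 * ρ / 4) ^ (-s)) ≤
        ∑' k : ℕ, (Metric.ball x (2 * ρ * (1 / 2) ^ k)).indicator
          (fun _ => ENNReal.ofReal ((2 * ρ * (1 / 2) ^ k / 4) ^ (-s))) x := by
      refine ENNReal.tsum_le_tsum fun k => ?_
      rw [indicator_of_mem (Metric.mem_ball_self (by positivity))]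
      refine ENNReal.ofReal_le_ofReal (Real.rpow_le_rpow_of_nonpos (by positivity) ?_
        (by linarith))
      have : (1 / 2 : ℝ) ^ k ≤ 1 := pow_le_one₀ (by norm_num) (by norm_num)
      have := mul_le_mul_of_nonneg_left this (by positivity : 0 ≤ 2 * ρ)
      linarith
    rw [ENNReal.tsum_const_eq_top_of_ne_zero
      (ENNReal.ofReal_pos.2 (Real.rpow_pos_of_pos (by positivity) _)).ne'] at hle
    exact le_top.trans hle
  · have hlt : dist x y < ρ := Metric.mem_ball'.1 hy
    -- Here 2^(-k-1)ρ < |x-y| ≤ 2^(-k)ρ. Doubling the radius to 2ρ·2^(-k) lets the open ball contain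
    -- the right endpoint.
    obtain ⟨k, hk1, hk2⟩ := exists_nat_pow_near_of_lt_one (div_pos h0 hρ)
      ((div_le_one hρ).2 hlt.le) (by norm_num : (0 : ℝ) < 1 / 2) (by norm_num)
    rw [lt_div_iff₀ hρ, pow_succ] at hk1
    rw [div_le_iff₀ hρ] at hk2
    refine le_trans ?_ (ENNReal.le_tsum k)
    rw [indicator_of_mem, edist_rpow_neg s h0]
    · refine ENNReal.ofReal_le_ofReal (Real.rpow_le_rpow_of_nonpos (by positivity) ?_
        (by linarith))
      linarith
    · rw [Metric.mem_ball']
      have : 0 < (1 / 2 : ℝ) ^ k * ρ := by positivity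
      linarith

/-- A Hedberg type estimate: the part of the potential near the pole is controlled by the geometric
mean of the densities of dimension `s` and `s + ε`. -/
lemma lintegral_ball_kernel_le {s ε m τ ρ : ℝ} (hs : 0 < s) (hε : 0 < ε) (hm : 0 ≤ m)
    (hτ : 0 ≤ τ) (hρ : 0 < ρ) (ν : Measure (Space d)) (x : Space d)
    (h1 : ∀ r, 0 < r → r ≤ 2 * ρ → ν (Metric.ball x r) ≤ ENNReal.ofReal (m * r ^ s))
    (h2 : ∀ r, 0 < r → r ≤ 2 * ρ → ν (Metric.ball x r) ≤ ENNReal.ofReal (τ * r ^ (s + ε))) :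
    ∫⁻ y in Metric.ball x ρ, edist x y ^ (-s) ∂ν ≤
      ENNReal.ofReal (4 ^ s * √(m * τ) * (2 * ρ) ^ (ε / 2) * (1 - (1 / 2) ^ (ε / 2))⁻¹) := by
  have hq0 : (0 : ℝ) ≤ (1 / 2) ^ (ε / 2) := by positivity
  have hq1 : (1 / 2 : ℝ) ^ (ε / 2) < 1 :=
    Real.rpow_lt_one (by norm_num) (by norm_num) (by positivity)
  -- The powers cancel: r^(-s) √(m r^s · τ r^(s+ε)) = √(mτ) r^(ε/2), which is geometric along dyadic
  -- radii.
  have hterm : ∀ k : ℕ, ENNReal.ofReal ((2 * ρ * (1 / 2) ^ k / 4) ^ (-s)) *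
      ν (Metric.ball x (2 * ρ * (1 / 2) ^ k)) ≤
      ENNReal.ofReal (4 ^ s * √(m * τ) * (2 * ρ) ^ (ε / 2) * ((1 / 2) ^ (ε / 2)) ^ k) := by
    intro k
    have hr : 0 < 2 * ρ * (1 / 2) ^ k := by positivity
    have hr2 : 2 * ρ * (1 / 2) ^ k ≤ 2 * ρ :=
      mul_le_of_le_one_right (by positivity) (pow_le_one₀ (by norm_num) (by norm_num))
    have hrp : (2 * ρ) ^ (ε / 2) * ((1 / 2) ^ (ε / 2)) ^ k = (2 * ρ * (1 / 2) ^ k) ^ (ε / 2) := by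
      rw [Real.mul_rpow (x := 2 * ρ) (y := (1 / 2) ^ k) (by positivity) (by positivity),
        Real.rpow_pow_comm (by norm_num)]
    rw [mul_assoc (4 ^ s * √(m * τ)), hrp]
    generalize 2 * ρ * (1 / 2) ^ k = r at hr hr2
    have hv := le_ofReal_mul_sqrt (by positivity) (by positivity) (h1 r hr hr2) (h2 r hr hr2)
    refine (mul_le_mul_right hv _).trans (le_of_eq ?_)
    rw [← ENNReal.ofReal_mul (by positivity)]
    congr 1
    have e1 : m * r ^ s * (τ * r ^ (s + ε)) = (m * τ) * (r ^ (s + ε / 2)) ^ 2 := by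
      rw [← Real.rpow_natCast, ← Real.rpow_mul hr.le]
      have : (s + ε / 2) * ((2 : ℕ) : ℝ) = s + (s + ε) := by push_cast; ring
      rw [this, Real.rpow_add hr s (s + ε)]
      ring
    rw [e1, Real.sqrt_mul (by positivity), Real.sqrt_sq (by positivity),
      Real.div_rpow hr.le (by norm_num), Real.rpow_neg hr.le, Real.rpow_neg (by norm_num),
      Real.rpow_add hr]
    have := Real.rpow_pos_of_pos hr s
    field_simp
  calc ∫⁻ y in Metric.ball x ρ, edist x y ^ (-s) ∂ν
      ≤ ∫⁻ y in Metric.ball x ρ, ∑' k : ℕ, (Metric.ball x (2 * ρ * (1 / 2) ^ k)).indicator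
          (fun _ => ENNReal.ofReal ((2 * ρ * (1 / 2) ^ k / 4) ^ (-s))) y ∂ν :=
        setLIntegral_mono' Metric.isOpen_ball.measurableSet
          fun y hy => edist_rpow_neg_le_tsum hs hρ hy
    _ ≤ ∫⁻ y, ∑' k : ℕ, (Metric.ball x (2 * ρ * (1 / 2) ^ k)).indicator
          (fun _ => ENNReal.ofReal ((2 * ρ * (1 / 2) ^ k / 4) ^ (-s))) y ∂ν :=
        setLIntegral_le_lintegral _ _
    _ = ∑' k : ℕ, ENNReal.ofReal ((2 * ρ * (1 / 2) ^ k / 4) ^ (-s)) *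
          ν (Metric.ball x (2 * ρ * (1 / 2) ^ k)) := by
        rw [lintegral_tsum fun k =>
          (measurable_const.indicator Metric.isOpen_ball.measurableSet).aemeasurable]
        simp_rw [lintegral_indicator_const Metric.isOpen_ball.measurableSet]
    _ ≤ ∑' k : ℕ, ENNReal.ofReal
          (4 ^ s * √(m * τ) * (2 * ρ) ^ (ε / 2) * ((1 / 2) ^ (ε / 2)) ^ k) :=
        ENNReal.tsum_le_tsum hterm
    _ = _ := by
        rw [← ENNReal.ofReal_tsum_of_nonneg (fun k => by positivity)
          ((summable_geometric_of_lt_one hq0 hq1).mul_left _), tsum_mul_left,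
          tsum_geometric_of_lt_one hq0 hq1]

/-- Decay of the derivative of the Riesz potential of a measure supported away from `a`. -/
lemma lintegral_compl_ball_le {s m R : ℝ} (hs : 0 < s) (hm : 0 ≤ m) (hR : 0 < R)
    (ν : Measure (Space d)) (a : Space d)
    (h : ∀ r, 0 < r → ν (Metric.ball a r) ≤ ENNReal.ofReal (m * r ^ s)) :
    ∫⁻ y in (Metric.ball a (2 * R))ᶜ, ENNReal.ofReal (dist a y ^ (-s - 1)) ∂ν ≤
      ENNReal.ofReal (m * 2 ^ s / R) := by
  have hpt : ∀ y ∈ (Metric.ball a (2 * R))ᶜ, ENNReal.ofReal (dist a y ^ (-s - 1)) ≤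
      ∑' k : ℕ, (Metric.ball a (2 * R * 2 ^ (k + 1))).indicator
        (fun _ => ENNReal.ofReal ((2 * R * 2 ^ k) ^ (-s - 1))) y := by
    intro y hy
    have hge : 2 * R ≤ dist a y := by
      rw [dist_comm]; simpa using hy
    obtain ⟨k, hk1, hk2⟩ := exists_nat_pow_near ((one_le_div (by positivity)).2 hge)
      (by norm_num : (1 : ℝ) < 2)
    rw [le_div_iff₀ (by positivity)] at hk1
    rw [div_lt_iff₀ (by positivity)] at hk2
    refine le_trans ?_ (ENNReal.le_tsum k)
    rw [indicator_of_mem]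
    · exact ENNReal.ofReal_le_ofReal (Real.rpow_le_rpow_of_nonpos (by positivity) (by linarith)
        (by linarith))
    · rw [Metric.mem_ball']
      linarith
  have hterm : ∀ k : ℕ, ENNReal.ofReal ((2 * R * 2 ^ k) ^ (-s - 1)) *
      ν (Metric.ball a (2 * R * 2 ^ (k + 1))) ≤
      ENNReal.ofReal (m * 2 ^ s / (2 * R) * (1 / 2) ^ k) := by
    intro k
    refine (mul_le_mul_right (h _ (by positivity)) _).trans (le_of_eq ?_)
    rw [← ENNReal.ofReal_mul (by positivity)]
    congr 1
    have e : (1 / 2 : ℝ) ^ k / (2 * R) = (2 * R * 2 ^ k)⁻¹ := by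
      rw [one_div, inv_pow]; field_simp
    have e2 : 2 * R * 2 ^ (k + 1) = 2 * (2 * R * 2 ^ k) := by ring
    rw [div_mul_eq_mul_div, mul_div_assoc, e, e2]
    have hr : 0 < 2 * R * 2 ^ k := by positivity
    generalize 2 * R * 2 ^ k = r at hr
    rw [Real.mul_rpow (by norm_num) hr.le, Real.rpow_sub hr, Real.rpow_neg hr.le, Real.rpow_one]
    have := Real.rpow_pos_of_pos hr s
    field_simp
  calc ∫⁻ y in (Metric.ball a (2 * R))ᶜ, ENNReal.ofReal (dist a y ^ (-s - 1)) ∂ν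
      ≤ ∫⁻ y in (Metric.ball a (2 * R))ᶜ, ∑' k : ℕ,
          (Metric.ball a (2 * R * 2 ^ (k + 1))).indicator
          (fun _ => ENNReal.ofReal ((2 * R * 2 ^ k) ^ (-s - 1))) y ∂ν :=
        setLIntegral_mono' Metric.isOpen_ball.measurableSet.compl hpt
    _ ≤ ∫⁻ y, ∑' k : ℕ, (Metric.ball a (2 * R * 2 ^ (k + 1))).indicator
          (fun _ => ENNReal.ofReal ((2 * R * 2 ^ k) ^ (-s - 1))) y ∂ν :=
        setLIntegral_le_lintegral _ _
    _ = ∑' k : ℕ, ENNReal.ofReal ((2 * R * 2 ^ k) ^ (-s - 1)) *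
          ν (Metric.ball a (2 * R * 2 ^ (k + 1))) := by
        rw [lintegral_tsum fun k =>
          (measurable_const.indicator Metric.isOpen_ball.measurableSet).aemeasurable]
        simp_rw [lintegral_indicator_const Metric.isOpen_ball.measurableSet]
    _ ≤ ∑' k : ℕ, ENNReal.ofReal (m * 2 ^ s / (2 * R) * (1 / 2) ^ k) :=
        ENNReal.tsum_le_tsum hterm
    _ = _ := by
        rw [← ENNReal.ofReal_tsum_of_nonneg (fun k => by positivity)
          ((summable_geometric_of_lt_one (by norm_num) (by norm_num)).mul_left _), tsum_mul_left,
          tsum_geometric_of_lt_one (by norm_num) (by norm_num)]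
        congr 1
        field_simp
        norm_num

/-- Mean value inequality on [q/2, ∞), which contains p because R ≤ q/2; there the derivative is at
most s(q/2)^(-s-1). -/
lemma abs_rpow_neg_sub_le {s R p q : ℝ} (hs : 0 < s) (hR : 0 < R) (hq : 2 * R ≤ q)
    (hpq : |p - q| ≤ R) :
    |p ^ (-s) - q ^ (-s)| ≤ s * 2 ^ (s + 1) * R * q ^ (-s - 1) := by
  have hq0 : 0 < q := by linarith
  have hp : q / 2 ≤ p := by linarith [(abs_le.1 hpq).1]
  have hderiv : ∀ z ∈ Ici (q / 2),
      HasDerivWithinAt (fun z : ℝ => z ^ (-s)) (-s * z ^ (-s - 1)) (Ici (q / 2)) z := fun z hz =>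
    (Real.hasDerivAt_rpow_const (Or.inl (by
      have : q / 2 ≤ z := hz
      exact ne_of_gt (by linarith)))).hasDerivWithinAt
  have hbound : ∀ z ∈ Ici (q / 2), ‖-s * z ^ (-s - 1)‖ ≤ s * (q / 2) ^ (-s - 1) := by
    intro z hz
    have hz' : q / 2 ≤ z := hz
    have hz0 : 0 < z := by linarith
    rw [norm_mul, norm_neg, Real.norm_of_nonneg hs.le,
      Real.norm_of_nonneg (Real.rpow_nonneg hz0.le _)]
    exact mul_le_mul_of_nonneg_left
      (Real.rpow_le_rpow_of_nonpos (by positivity) hz' (by linarith)) hs.le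
  have := (convex_Ici (q / 2)).norm_image_sub_le_of_norm_hasDerivWithin_le hderiv hbound
    (by simp only [mem_Ici]; linarith : q ∈ Ici (q / 2)) (mem_Ici.2 hp)
  simp only [Real.norm_eq_abs] at this
  refine this.trans ((mul_le_mul_of_nonneg_left hpq (by positivity)).trans (le_of_eq ?_))
  rw [Real.div_rpow hq0.le (by norm_num), show -s - 1 = -(s + 1) by ring,
    Real.rpow_neg (by norm_num : (0 : ℝ) ≤ 2)]
  field_simp

/-- Oscillation on `ball a R` of the potential of the part of `ν` outside `ball a (2 * R)`. -/
lemma far_potential_le_add {s m R : ℝ} (hs : 0 < s) (hm : 0 ≤ m) (hR : 0 < R)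
    (ν : Measure (Space d)) (a : Space d)
    (h : ∀ r, 0 < r → ν (Metric.ball a r) ≤ ENNReal.ofReal (m * r ^ s))
    {x : Space d} (hx : x ∈ Metric.ball a R) :
    (∫⁻ y in (Metric.ball a (2 * R))ᶜ, edist x y ^ (-s) ∂ν ≤
      ∫⁻ y in (Metric.ball a (2 * R))ᶜ, edist a y ^ (-s) ∂ν +
        ENNReal.ofReal (s * 2 ^ (s + 1) * 2 ^ s * m)) ∧
    (∫⁻ y in (Metric.ball a (2 * R))ᶜ, edist a y ^ (-s) ∂ν ≤
      ∫⁻ y in (Metric.ball a (2 * R))ᶜ, edist x y ^ (-s) ∂ν +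
        ENNReal.ofReal (s * 2 ^ (s + 1) * 2 ^ s * m)) := by
  set E : Space d → ℝ≥0∞ := fun y =>
    ENNReal.ofReal (s * 2 ^ (s + 1) * R) * ENNReal.ofReal (dist a y ^ (-s - 1)) with hE
  have hEm : Measurable E := by fun_prop
  have hEint : ∫⁻ y in (Metric.ball a (2 * R))ᶜ, E y ∂ν ≤
      ENNReal.ofReal (s * 2 ^ (s + 1) * 2 ^ s * m) := by
    rw [hE, lintegral_const_mul _ (by fun_prop)]
    refine (mul_le_mul_right (lintegral_compl_ball_le hs hm hR ν a h) _).trans (le_of_eq ?_)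
    rw [← ENNReal.ofReal_mul (by positivity)]
    congr 1
    field_simp
  have hpt : ∀ y ∈ (Metric.ball a (2 * R))ᶜ,
      edist x y ^ (-s) ≤ edist a y ^ (-s) + E y ∧ edist a y ^ (-s) ≤ edist x y ^ (-s) + E y := by
    intro y hy
    have hge : 2 * R ≤ dist a y := by
      rw [dist_comm]; simpa using hy
    have hxa : dist x a < R := hx
    have hpq : |dist x y - dist a y| ≤ R := (abs_dist_sub_le x a y).trans hxa.le
    have hb := abs_rpow_neg_sub_le hs hR hge hpq
    have ha0 : 0 < dist a y := by linarith
    have hx0 : 0 < dist x y := by linarith [(abs_le.1 hpq).1]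
    have hEy : E y = ENNReal.ofReal (s * 2 ^ (s + 1) * R * dist a y ^ (-s - 1)) := by
      rw [hE, ENNReal.ofReal_mul (p := s * 2 ^ (s + 1) * R) (by positivity)]
    rw [edist_rpow_neg s ha0, edist_rpow_neg s hx0, hEy,
      ← ENNReal.ofReal_add (by positivity) (by positivity),
      ← ENNReal.ofReal_add (by positivity) (by positivity)]
    exact ⟨ENNReal.ofReal_le_ofReal (by linarith [(abs_le.1 hb).2]),
      ENNReal.ofReal_le_ofReal (by linarith [(abs_le.1 hb).1])⟩
  have hmeas := (Metric.isOpen_ball (x := a) (ε := 2 * R)).measurableSet.compl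
  constructor
  · refine (setLIntegral_mono' hmeas fun y hy => (hpt y hy).1).trans ?_
    rw [lintegral_add_right _ hEm]
    gcongr
  · refine (setLIntegral_mono' hmeas fun y hy => (hpt y hy).2).trans ?_
    rw [lintegral_add_right _ hEm]
    gcongr

/-! ### Extended-real arithmetic and integration of level sets -/

/-- If an error bound is infinite there is nothing to prove; otherwise A and B are finite and this
is the triangle inequality for reals. The case ∞ - ∞ thus never needs separate treatment. -/
lemma abs_coe_sub_coe_sub_le {A B G₁ G₂ P₁ P₂ : ℝ≥0∞} (hG₁ : G₁ ≠ ∞) (hG₂ : G₂ ≠ ∞)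
    (h1 : A ≤ G₁ + P₁) (h1' : G₁ ≤ A + P₁) (h2 : B ≤ G₂ + P₂) (h2' : G₂ ≤ B + P₂) :
    ((A : EReal) - (B : EReal) - ((G₁.toReal - G₂.toReal : ℝ) : EReal)).abs ≤ P₁ + P₂ := by
  rcases eq_or_ne P₁ ∞ with rfl | hP₁
  · simp
  rcases eq_or_ne P₂ ∞ with rfl | hP₂
  · simp
  have hA : A ≠ ∞ := ne_top_of_le_ne_top (by finiteness) h1
  have hB : B ≠ ∞ := ne_top_of_le_ne_top (by finiteness) h2
  lift A to NNReal using hA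
  lift B to NNReal using hB
  lift G₁ to NNReal using hG₁
  lift G₂ to NNReal using hG₂
  lift P₁ to NNReal using hP₁
  lift P₂ to NNReal using hP₂
  norm_cast at h1 h1' h2 h2'
  have e : ((A : ℝ≥0∞) : EReal) - ((B : ℝ≥0∞) : EReal) -
      ((((G₁ : ℝ≥0∞).toReal - (G₂ : ℝ≥0∞).toReal : ℝ)) : EReal) =
      (((A : ℝ) - B - (G₁ - G₂) : ℝ) : EReal) := by
    push_cast
    rfl
  rw [e, EReal.abs_def]
  refine ENNReal.ofReal_le_of_le_toReal ?_
  rw [← ENNReal.coe_add, ENNReal.coe_toReal]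
  have := NNReal.coe_le_coe.2 h1
  have := NNReal.coe_le_coe.2 h1'
  have := NNReal.coe_le_coe.2 h2
  have := NNReal.coe_le_coe.2 h2'
  push_cast at *
  rw [abs_le]
  constructor <;> linarith

/-- The convention ∞ - ∞ = `⊥`, with absolute value ∞, makes this hold even when both terms are
infinite. -/
lemma ne_top_of_abs_coe_sub_coe {A B : ℝ≥0∞} (h : ((A : EReal) - (B : EReal)).abs ≠ ∞) :
    A ≠ ∞ ∧ B ≠ ∞ := by
  constructor
  · rintro rfl
    rcases eq_or_ne B ∞ with rfl | hB
    · simp at h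
    · lift B to NNReal using hB
      exact h rfl
  · rintro rfl
    exact h (by simp [sub_eq_add_neg])

/-- Integration of the level sets estimate `g t ≤ min A (B / t ^ 2)`. -/
lemma lintegral_Ioi_le_of_decay {g : ℝ → ℝ≥0∞} {A B T : ℝ} (hT : 0 < T) (hA : 0 ≤ A)
    (hB : 0 ≤ B) (h1 : ∀ t, g t ≤ ENNReal.ofReal A)
    (h2 : ∀ t, T < t → g t ≤ ENNReal.ofReal (B * t ^ (-2 : ℝ))) :
    ∫⁻ t in Ioi (0 : ℝ), g t ≤ ENNReal.ofReal (A * T + B / T) := by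
  rw [← Ioc_union_Ioi_eq_Ioi hT.le, ENNReal.ofReal_add (by positivity) (by positivity)]
  refine (lintegral_union_le _ _ _).trans (add_le_add ?_ ?_)
  · refine (lintegral_mono h1).trans (le_of_eq ?_)
    rw [setLIntegral_const, Real.volume_Ioc, sub_zero, ← ENNReal.ofReal_mul hA]
  · refine (setLIntegral_mono' measurableSet_Ioi h2).trans (le_of_eq ?_)
    have hint := (integrableOn_Ioi_rpow_of_lt (by norm_num : (-2 : ℝ) < -1) hT).const_mul B
    rw [← ofReal_integral_eq_lintegral_ofReal hint
      (ae_restrict_of_forall_mem measurableSet_Ioi fun t ht =>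
        mul_nonneg hB (Real.rpow_nonneg (hT.trans ht).le _)),
      integral_const_mul, integral_Ioi_rpow_of_lt (by norm_num) hT]
    congr 1
    norm_num
    rw [Real.rpow_neg_one, div_eq_mul_inv]

end Kernel

/-! ### Mean oscillation of the potential on a cube -/

lemma rieszConst_pos {d : ℕ} {α : ℝ} (hα : 0 < α) (hαd : α < d) : 0 < rieszConst d α :=
  div_pos (mul_pos (by positivity) (Real.Gamma_pos_of_pos (by positivity)))
    (Real.Gamma_pos_of_pos (by linarith))

lemma rieszPotentialPos_eq_add {d : ℕ} (α : ℝ) (ν : Measure (Space d)) (a : Space d) (R : ℝ)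
    (x : Space d) :
    rieszPotentialPos α ν x =
      ENNReal.ofReal (rieszConst d α)⁻¹ *
          ∫⁻ y in Metric.ball a R, edist x y ^ (-((d : ℝ) - α)) ∂ν +
        ENNReal.ofReal (rieszConst d α)⁻¹ *
          ∫⁻ y in (Metric.ball a R)ᶜ, edist x y ^ (-((d : ℝ) - α)) ∂ν := by
  rw [← mul_add, lintegral_add_compl _ Metric.isOpen_ball.measurableSet, rieszPotentialPos]

/-- The potential differs on `ball a R` from a suitable constant by at most the local part of the
potential of the total variation plus a multiple of the Morrey norm. -/
lemma exists_abs_rieszPotential_sub_le {d : ℕ} {α m R : ℝ} (hα : 0 < α) (hαd : α < d)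
    (hm : 0 ≤ m) (hR : 0 < R) (μ : SignedRadonMeasure d) (a : Space d)
    (h : ∀ r, 0 < r → μ.variation (Metric.ball a r) ≤ ENNReal.ofReal (m * r ^ ((d : ℝ) - α)))
    (hfin : ∃ x ∈ Metric.ball a R, (rieszPotential α μ x).abs ≠ ∞) :
    ∃ c : ℝ, ∀ x ∈ Metric.ball a R, (rieszPotential α μ x - (c : EReal)).abs ≤
      ENNReal.ofReal (rieszConst d α)⁻¹ *
          ∫⁻ y in Metric.ball a (2 * R), edist x y ^ (-((d : ℝ) - α)) ∂μ.variation +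
        ENNReal.ofReal ((rieszConst d α)⁻¹ * 2 *
          (((d : ℝ) - α) * 2 ^ ((d : ℝ) - α + 1) * 2 ^ ((d : ℝ) - α)) * m) := by
  set s := (d : ℝ) - α with hsdef
  have hs : 0 < s := by linarith
  have hγ : 0 < (rieszConst d α)⁻¹ := inv_pos.2 (rieszConst_pos hα hαd)
  set γ := (rieszConst d α)⁻¹ with hγdef
  set k := s * 2 ^ (s + 1) * 2 ^ s with hk
  have hk0 : 0 < k := by positivity
  have hpos : ∀ r, 0 < r → μ.posPart (Metric.ball a r) ≤ ENNReal.ofReal (m * r ^ s) :=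
    fun r hr => le_trans (by simp [SignedRadonMeasure.variation]) (h r hr)
  have hneg : ∀ r, 0 < r → μ.negPart (Metric.ball a r) ≤ ENNReal.ofReal (m * r ^ s) :=
    fun r hr => le_trans (by simp [SignedRadonMeasure.variation]) (h r hr)
  let N : Measure (Space d) → Space d → ℝ≥0∞ := fun ν x =>
    ENNReal.ofReal γ * ∫⁻ y in Metric.ball a (2 * R), edist x y ^ (-s) ∂ν
  let F : Measure (Space d) → Space d → ℝ≥0∞ := fun ν x =>
    ENNReal.ofReal γ * ∫⁻ y in (Metric.ball a (2 * R))ᶜ, edist x y ^ (-s) ∂ν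
  have hNF : ∀ ν x, rieszPotentialPos α ν x = N ν x + F ν x := fun ν x =>
    rieszPotentialPos_eq_add α ν a (2 * R) x
  have hF : ∀ ν : Measure (Space d),
      (∀ r, 0 < r → ν (Metric.ball a r) ≤ ENNReal.ofReal (m * r ^ s)) →
      ∀ x ∈ Metric.ball a R, F ν x ≤ F ν a + ENNReal.ofReal (γ * k * m) ∧
        F ν a ≤ F ν x + ENNReal.ofReal (γ * k * m) := by
    intro ν hν x hx
    obtain ⟨h1, h2⟩ := far_potential_le_add hs hm hR ν a hν hx
    rw [mul_assoc, ENNReal.ofReal_mul hγ.le]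
    simp only [F]
    rw [← mul_add, ← mul_add]
    exact ⟨mul_le_mul_right h1 _, mul_le_mul_right h2 _⟩
  -- Finiteness at one point of the ball passes to the center, since the far potentials at the two
  -- points differ by a finite amount.
  have hFfin : F μ.posPart a ≠ ∞ ∧ F μ.negPart a ≠ ∞ := by
    obtain ⟨x, hx, hxfin⟩ := hfin
    obtain ⟨h1, h2⟩ := ne_top_of_abs_coe_sub_coe hxfin
    rw [hNF] at h1 h2
    exact ⟨ne_top_of_le_ne_top (ENNReal.add_ne_top.2 ⟨(ENNReal.add_ne_top.1 h1).2,
        ENNReal.ofReal_ne_top⟩) (hF _ hpos x hx).2,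
      ne_top_of_le_ne_top (ENNReal.add_ne_top.2 ⟨(ENNReal.add_ne_top.1 h2).2,
        ENNReal.ofReal_ne_top⟩) (hF _ hneg x hx).2⟩
  refine ⟨(F μ.posPart a).toReal - (F μ.negPart a).toReal, fun x hx => ?_⟩
  have key := abs_coe_sub_coe_sub_le (A := rieszPotentialPos α μ.posPart x)
    (B := rieszPotentialPos α μ.negPart x)
    (P₁ := N μ.posPart x + ENNReal.ofReal (γ * k * m))
    (P₂ := N μ.negPart x + ENNReal.ofReal (γ * k * m)) hFfin.1 hFfin.2
    (by rw [hNF, add_left_comm]; gcongr; exact (hF _ hpos x hx).1)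
    (by
      rw [hNF, add_add_add_comm]
      exact (hF _ hpos x hx).2.trans le_add_self)
    (by rw [hNF, add_left_comm]; gcongr; exact (hF _ hneg x hx).1)
    (by
      rw [hNF, add_add_add_comm]
      exact (hF _ hneg x hx).2.trans le_add_self)
  refine key.trans (le_of_eq ?_)
  rw [add_add_add_comm, ← ENNReal.ofReal_add (by positivity) (by positivity),
    SignedRadonMeasure.variation, Measure.restrict_add, lintegral_add_measure, mul_add]
  congr 2
  ring

/-- Weak type estimate for the local part of the potential. -/
lemma hausdorffContent_local_potential_le {d : ℕ} {s ε m R γ t : ℝ} (hs : 0 < s) (hε : 0 < ε)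
    (hm : 0 < m) (hR : 0 < R) (hγ : 0 < γ) (ht : 0 < t) (ν : Measure (Space d)) (a : Space d)
    (h : ∀ x r, 0 < r → ν (Metric.ball x r) ≤ ENNReal.ofReal (m * r ^ s)) :
    hausdorffContent (s + ε) {x | x ∈ Metric.ball a R ∧ ENNReal.ofReal t <
        ENNReal.ofReal γ * ∫⁻ y in Metric.ball a (2 * R), edist x y ^ (-s) ∂ν} ≤
      ENNReal.ofReal (omega (s + ε) * 6 ^ (s + ε) *
        (γ * 4 ^ s * (1 - (1 / 2) ^ (ε / 2))⁻¹) ^ 2 * 6 ^ ε * 13 ^ s * R ^ (s + ε) * m ^ 2 *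
          t ^ (-2 : ℝ)) := by
  have hβ : 0 < s + ε := by positivity
  have hω := omega_pos hβ
  have hq1 : (1 / 2 : ℝ) ^ (ε / 2) < 1 :=
    Real.rpow_lt_one (by norm_num) (by norm_num) (by positivity)
  have hD : 0 < (1 - (1 / 2 : ℝ) ^ (ε / 2))⁻¹ := inv_pos.2 (by linarith)
  set D := (1 - (1 / 2 : ℝ) ^ (ε / 2))⁻¹
  have hA : 0 < γ * 4 ^ s * D := by positivity
  set A := γ * 4 ^ s * D with hAdef
  -- Chosen so that A √(mτ) (6R)^(ε/2) = t exactly.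
  set τ := (t / A) ^ 2 / (m * (6 * R) ^ ε) with hτdef
  have hτ : 0 < τ := by positivity
  have hball : ν (Metric.ball a (R + 2 * (6 * R))) ≤ ENNReal.ofReal (m * (13 * R) ^ s) := by
    rw [show R + 2 * (6 * R) = 13 * R by ring]
    exact h a _ (by positivity)
  -- B(a,2R) lies in B(x,3R), and the kernel estimate there uses radii up to 6R; hence L = 6R and
  -- the mass of B(a,13R).
  have hweak := hausdorffContent_maximal_le hβ ν a (R := R) (L := 6 * R) (by positivity) hτ
    (ne_top_of_le_ne_top ENNReal.ofReal_ne_top hball)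
  refine (hausdorffContent_mono ?_).trans (hweak.trans ((mul_le_mul_right hball _).trans
    (le_of_eq ?_)))
  · rintro x ⟨hx, hlt⟩
    refine ⟨hx, ?_⟩
    by_contra hcon
    push Not at hcon
    refine hlt.not_ge ?_
    have hsub : Metric.ball a (2 * R) ⊆ Metric.ball x (3 * R) := by
      refine Metric.ball_subset_ball' ?_
      have := Metric.mem_ball'.1 hx
      linarith
    have hloc := lintegral_ball_kernel_le hs hε hm.le hτ.le (ρ := 3 * R) (by positivity) ν x
      (fun r hr _ => h x r hr) (fun r hr hr' => hcon r hr (by linarith))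
    refine (mul_le_mul_right ((lintegral_mono_set hsub).trans hloc) _).trans (le_of_eq ?_)
    rw [← ENNReal.ofReal_mul hγ.le]
    congr 1
    have e1 : m * τ = (t / A) ^ 2 / (6 * R) ^ ε := by rw [hτdef]; field_simp
    have e2 : (6 * R) ^ ε = ((6 * R) ^ (ε / 2)) ^ 2 := by
      rw [← Real.rpow_natCast, ← Real.rpow_mul (by positivity)]
      congr 1
      push_cast
      ring
    have h6 : 0 < (6 * R) ^ (ε / 2) := by positivity
    rw [e1, e2, ← div_pow, Real.sqrt_sq (by positivity), show 2 * (3 * R) = 6 * R by ring]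
    have : γ * (4 ^ s * (t / A / (6 * R) ^ (ε / 2)) * (6 * R) ^ (ε / 2) * D) = A * (t / A) := by
      rw [hAdef]
      field_simp
    rw [this, mul_div_cancel₀ _ hA.ne']
  · rw [← ENNReal.ofReal_mul (by positivity)]
    congr 1
    rw [hτdef, Real.mul_rpow (by norm_num) hR.le, Real.mul_rpow (by norm_num) hR.le,
      Real.rpow_neg ht.le, Real.rpow_two, Real.rpow_add hR]
    field_simp

/-- The constant in the bound of the mean oscillation. -/
def oscillationConst (d : ℕ) (α ε : ℝ) : ℝ :=
  let s := (d : ℝ) - α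
  let γ := (rieszConst d α)⁻¹
  let T := 2 * (γ * 2 * (s * 2 ^ (s + 1) * 2 ^ s))
  omega (s + ε) * (√d + 1) ^ (s + ε) *
    (T + 6 ^ (s + ε) * (γ * 4 ^ s * (1 - (1 / 2) ^ (ε / 2))⁻¹) ^ 2 * 6 ^ ε * 13 ^ s * 4 / T)

lemma oscillationConst_pos {d : ℕ} {α ε : ℝ} (hα : 0 < α) (hαd : α < d) (hε : 0 < ε) :
    0 < oscillationConst d α ε := by
  have hs : 0 < (d : ℝ) - α := by linarith
  have hω := omega_pos (add_pos hs hε)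
  have hγ := rieszConst_pos hα hαd
  unfold oscillationConst
  positivity

lemma choquetIntegral_cube_le {d : ℕ} {α ε m l : ℝ} (hα : 0 < α) (hαd : α < d) (hε : 0 < ε)
    (hm : 0 < m) (hl : 0 < l) (μ : SignedRadonMeasure d) (a : Space d)
    (h : ∀ x r, 0 < r → μ.variation (Metric.ball x r) ≤ ENNReal.ofReal (m * r ^ ((d : ℝ) - α)))
    (hfin : ∃ x ∈ cube a l, (rieszPotential α μ x).abs ≠ ∞) :
    ∃ c : ℝ, choquetIntegral (hausdorffContent ((d : ℝ) - α + ε)) (cube a l)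
      (fun x => (rieszPotential α μ x - (c : EReal)).abs) ≤
        ENNReal.ofReal (oscillationConst d α ε * m * l ^ ((d : ℝ) - α + ε)) := by
  have hR : 0 < (√d + 1) * l := by positivity
  have hQ := cube_subset_ball a hl
  obtain ⟨x₀, hx₀, hx₀fin⟩ := hfin
  obtain ⟨c, hc⟩ := exists_abs_rieszPotential_sub_le hα hαd hm.le hR μ a (fun r hr => h a r hr)
    ⟨x₀, hQ hx₀, hx₀fin⟩
  refine ⟨c, ?_⟩
  unfold oscillationConst
  set s := (d : ℝ) - α with hsdef
  have hs : 0 < s := by linarith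
  have hβ : 0 < s + ε := by positivity
  have hω := omega_pos hβ
  have hγ : 0 < (rieszConst d α)⁻¹ := inv_pos.2 (rieszConst_pos hα hαd)
  set γ := (rieszConst d α)⁻¹ with hγdef
  set k := γ * 2 * (s * 2 ^ (s + 1) * 2 ^ s) with hk
  have hk0 : 0 < k := by positivity
  set R := (√d + 1) * l with hRdef
  set W := 6 ^ (s + ε) * (γ * 4 ^ s * (1 - (1 / 2) ^ (ε / 2))⁻¹) ^ 2 * 6 ^ ε * 13 ^ s with hW
  have hW0 : 0 ≤ W := by positivity
  -- The far error is k·m. Above T = 2km it is below t/2, so the near part must exceed t/2; the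
  -- square of this 2 is the factor 4 in B. As T is proportional to m, both AT and B/T are
  -- proportional to m R^β.
  refine (lintegral_Ioi_le_of_decay (A := omega (s + ε) * R ^ (s + ε))
    (B := omega (s + ε) * W * R ^ (s + ε) * m ^ 2 * 4) (T := 2 * k * m) (by positivity)
    (by positivity) (by positivity) (fun t => ?_) (fun t ht => ?_)).trans (le_of_eq ?_)
  · exact (hausdorffContent_mono fun x hx => hQ hx.1).trans (hausdorffContent_ball_le hβ a hR)
  · have ht0 : 0 < t := lt_trans (by positivity) ht
    refine le_trans (hausdorffContent_mono ?_)
      ((hausdorffContent_local_potential_le (t := t / 2) hs hε hm hR hγ (by positivity)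
        μ.variation a h).trans (le_of_eq ?_))
    · rintro x ⟨hx, hlt⟩
      refine ⟨hQ hx, ?_⟩
      by_contra hcon
      rw [not_lt] at hcon
      refine hlt.not_ge ((hc x (hQ hx)).trans ((add_le_add_left hcon _).trans ?_))
      rw [← ENNReal.ofReal_add (by positivity) (by positivity)]
      exact ENNReal.ofReal_le_ofReal (by linarith)
    · congr 1
      rw [Real.rpow_neg ht0.le, Real.rpow_neg (by positivity), Real.rpow_two, Real.rpow_two, hW]
      field_simp
      ring
  · congr 1
    change _ = omega (s + ε) * (√d + 1) ^ (s + ε) * (2 * k + W * 4 / (2 * k)) * m * l ^ (s + ε)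
    rw [hRdef, Real.mul_rpow (by positivity) hl.le]
    clear_value k W
    field_simp

/-! ### Finiteness on cubes and the final bound -/

/-- Otherwise every level set would contain the cube, whose content is positive because β ≤ d, and
the Choquet integral over a compact ball would be infinite. -/
lemma exists_abs_ne_top {d : ℕ} {β : ℝ} (hβ : 0 < β) (hβd : β ≤ d) {f : Space d → EReal}
    (hf : ∀ K : Set (Space d), IsCompact K → MemL1 β K f) (a : Space d) {l : ℝ} (hl : 0 < l) :
    ∃ x ∈ cube a l, (f x).abs ≠ ∞ := by
  by_contra! hcon
  have hK := (hf _ (isCompact_closedBall a ((√d + 1) * l))).2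
  refine hK.not_ge ?_
  have hQ : cube a l ⊆ Metric.closedBall a ((√d + 1) * l) :=
    (cube_subset_ball a hl).trans Metric.ball_subset_closedBall
  calc ∞ = ∫⁻ _t in Ioi (0 : ℝ), hausdorffContent β (cube a l) := by
        rw [setLIntegral_const, Real.volume_Ioi,
          ENNReal.mul_top (hausdorffContent_cube_pos hβ hβd a hl).ne']
    _ ≤ _ := by
        refine lintegral_mono fun t => hausdorffContent_mono fun x hx => ?_
        refine And.intro (hQ hx) ?_
        simp only [hcon x hx]
        exact ENNReal.ofReal_lt_top

lemma bmoSeminorm_rieszPotential_le {d : ℕ} {α ε m : ℝ} (hα : 0 < α) (hαd : α < d) (hε : 0 < ε)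
    (hm : 0 < m) (μ : SignedRadonMeasure d)
    (h : morreyNorm ((d : ℝ) - α) μ ≤ ENNReal.ofReal m)
    (hfin : ∀ a l, 0 < l → ∃ x ∈ cube a l, (rieszPotential α μ x).abs ≠ ∞) :
    bmoSeminorm ((d : ℝ) - α + ε) (rieszPotential α μ) ≤
      ENNReal.ofReal (oscillationConst d α ε * m) := by
  have hball : ∀ x r, 0 < r →
      μ.variation (Metric.ball x r) ≤ ENNReal.ofReal (m * r ^ ((d : ℝ) - α)) := by
    intro x r hr
    have hr' : 0 < r ^ ((d : ℝ) - α) := Real.rpow_pos_of_pos hr _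
    rw [ENNReal.ofReal_mul hm.le, ← ENNReal.div_le_iff (ENNReal.ofReal_pos.2 hr').ne'
      ENNReal.ofReal_ne_top]
    exact le_trans (le_iSup_of_le x <| le_iSup₂ (f := fun r (_ : 0 < r) =>
      μ.variation (Metric.ball x r) / ENNReal.ofReal (r ^ ((d : ℝ) - α))) r hr) h
  refine iSup_le fun a => iSup_le fun l => iSup_le fun hl => ?_
  obtain ⟨c, hc⟩ := choquetIntegral_cube_le hα hαd hε hm hl μ a hball (hfin a l hl)
  refine iInf_le_of_le c (ENNReal.div_le_of_le_mul (hc.trans (le_of_eq ?_)))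
  rw [ENNReal.ofReal_mul (mul_pos (oscillationConst_pos hα hαd hε) hm).le]

end HausdorffBMO

end

theorem theorem1p7 (d : ℕ) (α ε : ℝ) (hα : 0 < α) (hαd : α < (d : ℝ)) (hε : 0 < ε)
    (hεα : ε ≤ α) :
    ∃ C : ℝ, 0 < C ∧ ∀ μ : HausdorffBMO.SignedRadonMeasure d,
      HausdorffBMO.morreyNorm ((d : ℝ) - α) μ < ∞ →
      (∀ K : Set (HausdorffBMO.Space d), IsCompact K →
        HausdorffBMO.MemL1 ((d : ℝ) - α + ε) K (HausdorffBMO.rieszPotential α μ)) →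
      HausdorffBMO.bmoSeminorm ((d : ℝ) - α + ε) (HausdorffBMO.rieszPotential α μ) ≤
        ENNReal.ofReal C * HausdorffBMO.morreyNorm ((d : ℝ) - α) μ := by
  have hC := HausdorffBMO.oscillationConst_pos hα hαd hε
  refine ⟨HausdorffBMO.oscillationConst d α ε, hC, fun μ hμ hL => ?_⟩
  have hfin := fun a l (hl : 0 < l) =>
    HausdorffBMO.exists_abs_ne_top (by linarith) (by linarith) hL a hl
  -- The estimate needs a positive m while the Morrey norm may vanish, so m exceeds the norm by δ
  -- divided by the constant, which costs exactly δ.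
  refine ENNReal.le_of_forall_pos_le_add fun δ hδ _ => ?_
  set M := (HausdorffBMO.morreyNorm ((d : ℝ) - α) μ).toReal with hM
  have hδ' : (0 : ℝ) < δ := hδ
  have hη : 0 < (δ : ℝ) / HausdorffBMO.oscillationConst d α ε := by positivity
  have hM0 : 0 ≤ M := ENNReal.toReal_nonneg
  have hle := HausdorffBMO.bmoSeminorm_rieszPotential_le hα hαd hε
    (m := M + δ / HausdorffBMO.oscillationConst d α ε) (by positivity) μ
    (by
      rw [← ENNReal.ofReal_toReal hμ.ne, ← hM]
      exact ENNReal.ofReal_le_ofReal (by linarith)) hfin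
  refine hle.trans (le_of_eq ?_)
  rw [mul_add, mul_div_cancel₀ _ hC.ne', ENNReal.ofReal_add (by positivity) hδ'.le,
    ENNReal.ofReal_mul hC.le, hM, ENNReal.ofReal_toReal hμ.ne, ENNReal.ofReal_coe_nnreal]
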